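/- **Theorem (Head Effect in the Dynamic Model).** Let $N$ streamers share a fixed pool of $M>0$ viewers. At time $t\ge 0$ streamer $i$ has audience $n_i(t)$ and content quality $q_i(t)$, where $q_i(t)$ lies in a fixed set $Q\subseteq\mathbb R$, and $$\dot n_i=\gamma\,[M P_i-n_i],\qquad \dot q_i=\eta_i\Big[(1-\tau)R\,\frac{\partial (M P_i)}{\partial q_i}-c'(q_i)\Big],\qquad P_i=\frac{\exp(\alpha_i q_i-p_i+\beta n_i)}{\sum_{k=1}^N\exp(\alpha_k q_k-p_k+\beta n_k)},$$ the partial derivative being taken with all other arguments of $P_i$ fixed. Here $\gamma,R,\alpha_i,\eta_i>0$, $0\le\tau\le1$, $p_i\in\mathbb R$; $Q$ is convex, and the cost $c$ is differentiable, strictly increasing and convex on $Q$. Initially $n_i(0)\ge0$ and $\sum_i n_i(0)=M$. Let the streamers be identical: $\alpha_i=\alpha$, $p_i=p$, $\eta_i=\eta$ and $q_i(0)=q_0$ for all $i$. Put $s_i=n_i/M$ and $\mathrm{HHI}=\sum_{i=1}^N s_i^2$. Then for every $\varepsilon>0$ there is $\beta_0>0$, independent of $q_0$ and of the initial audiences,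 such that for every $\beta\ge\beta_0$ and every solution on $[0,\infty)$: 1. If streamer $i$ has strictly the largest initial audience, $n_i(0)>n_j(0)$ for all $j\ne i$, by however small a margin, then for all sufficiently large $t$ $$|s_i(t)-1|<\varepsilon,\qquad |s_j(t)|<\varepsilon\ (j\ne i),\qquad |\mathrm{HHI}(t)-1|<\varepsilon .$$ 2. If the initial audiences are random and $\Pr[n_i(0)=n_j(0)]=0$ for all $i\neq j$, then almost surely there is a streamer $i$ with strictly the largest initial audience, and the conclusion of 1 holds for it. -/

import Mathlib

/-- A live streaming platform with `N` streamers, all data except the network-effect parameter `β`.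
`Q` is the range of admissible content qualities, for instance `Set.Ici 0` or `Set.univ`. -/
structure StreamingMarket (N : ℕ) where
  /-- total number of viewers -/
  M : ℝ
  /-- adjustment rate of the viewers -/
  γ : ℝ
  /-- average revenue per viewer -/
  R : ℝ
  /-- commission rate of the platform -/
  τ : ℝ
  /-- intrinsic attractiveness of each streamer -/
  α : Fin N → ℝ
  /-- price of each streamer -/
  p : Fin N → ℝ
  /-- speed at which each streamer adjusts content quality -/
  η : Fin N → ℝ
  /-- range of admissible qualities -/
  Q : Set ℝ
  /-- cost of quality -/
  c : ℝ → ℝ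
  M_pos : 0 < M
  γ_pos : 0 < γ
  R_pos : 0 < R
  τ_nonneg : 0 ≤ τ
  τ_le_one : τ ≤ 1
  α_pos : ∀ i, 0 < α i
  η_pos : ∀ i, 0 < η i
  c_convex : ConvexOn ℝ Q c
  c_strictMono : StrictMonoOn c Q
  c_differentiable : ∀ x ∈ Q, DifferentiableAt ℝ c x

namespace StreamingMarket

variable {N : ℕ}

/-- The streamers have identical intrinsic characteristics. -/
def Identical (mkt : StreamingMarket N) : Prop :=
  (∀ i j, mkt.α i = mkt.α j) ∧ (∀ i j, mkt.p i = mkt.p j) ∧ (∀ i j, mkt.η i = mkt.η j)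

/-- Deterministic part of a viewer's utility, `α_i q_i - p_i + β n_i`. -/
def utility (mkt : StreamingMarket N) (β : ℝ) (q n : Fin N → ℝ) (i : Fin N) : ℝ :=
  mkt.α i * q i - mkt.p i + β * n i

/-- Multinomial logit probability that a viewer chooses streamer `i`. -/
noncomputable def choiceProb (mkt : StreamingMarket N) (β : ℝ) (q n : Fin N → ℝ) (i : Fin N) : ℝ :=
  Real.exp (mkt.utility β q n i) / ∑ k, Real.exp (mkt.utility β q n k)

/-- The marginal audience `∂n_i/∂q_i`: the derivative of the expected audience `M P_i` in the
quality `q_i`, all the other arguments of `P_i` being held fixed. -/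
noncomputable def marginalAudience (mkt : StreamingMarket N) (β : ℝ) (q n : Fin N → ℝ)
    (i : Fin N) : ℝ :=
  deriv (fun x : ℝ => mkt.M * mkt.choiceProb β (Function.update q i x) n i) (q i)

/-- `n t i` and `q t i` are the audience and the quality of streamer `i` at time `t ≥ 0`; they solve
the viewer and the quality equations, and the `M` viewers are distributed among the streamers at
time `0`. -/
structure IsTrajectory (mkt : StreamingMarket N) (β : ℝ) (n q : ℝ → Fin N → ℝ) : Prop where
  initial_nonneg : ∀ i, 0 ≤ n 0 i
  initial_sum : ∑ i, n 0 i = mkt.M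
  quality_mem : ∀ t, 0 ≤ t → ∀ i, q t i ∈ mkt.Q
  viewer_eq : ∀ t, 0 ≤ t → ∀ i,
    HasDerivWithinAt (fun s => n s i)
      (mkt.γ * (mkt.M * mkt.choiceProb β (q t) (n t) i - n t i)) (Set.Ici 0) t
  quality_eq : ∀ t, 0 ≤ t → ∀ i,
    HasDerivWithinAt (fun s => q s i)
      (mkt.η i * ((1 - mkt.τ) * mkt.R * mkt.marginalAudience β (q t) (n t) i
        - deriv mkt.c (q t i))) (Set.Ici 0) t

/-- Market share of streamer `i`. -/
noncomputable def share (mkt : StreamingMarket N) (n : Fin N → ℝ) (i : Fin N) : ℝ :=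
  n i / mkt.M

/-- Herfindahl-Hirschman index. -/
noncomputable def hhi (mkt : StreamingMarket N) (n : Fin N → ℝ) : ℝ :=
  ∑ i, mkt.share n i ^ 2

/-- Streamer `i` dominates up to `ε`: its share is within `ε` of `1`, every other share is within
`ε` of `0`, and the Herfindahl-Hirschman index is within `ε` of `1`. -/
def Dominates (mkt : StreamingMarket N) (ε : ℝ) (n : Fin N → ℝ) (i : Fin N) : Prop :=
  |mkt.share n i - 1| < ε ∧ (∀ j, j ≠ i → |mkt.share n j| < ε) ∧ |mkt.hhi n - 1| < ε

end StreamingMarket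

/-! A lead in audience feeds on itself. Starting from equal qualities, the leader `i` has the higher
utility, hence the larger logit probability. Since `P_i (1 - P_i) - P_j (1 - P_j) = (P_i - P_j) (1 -
P_i - P_j) ≥ 0` and `c'` is monotone, its quality cannot fall below a rival's, so the lead never
ends (`lead_persists`) and the utility gap is at least `β` times the audience gap `x = n_i - n_j`.

Now `x' = γ (M (P_i - P_j) - x)`. For large `β` the first term beats `x` while `x < M / (2N)`, so
even a tiny `x` grows exponentially to that level (`eventually_audience_gap_ge`). There the utility
gap is at least `β M / (2N)`, which forces `P_i` close to `1` (`eventually_choiceProb_ge`), and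
`n_i` relaxes towards `M P_i`. The thresholds on `β` involve only `N`, `M` and `ε`; the initial
margin affects only the waiting time. -/

open Set Filter Topology

/-! ### Scalar differential inequalities on `[0, ∞)` -/

section Comparison

variable {f f' : ℝ → ℝ} {a b κ c : ℝ}

/-- A function on `[0, ∞)` whose derivative is nonnegative on `(a, b)` does not decrease from `a`
to `b`. -/
theorem le_of_hasDerivWithinAt_Ici_nonneg
    (hf : ∀ t, 0 ≤ t → HasDerivWithinAt f (f' t) (Ici 0) t) (ha : 0 ≤ a) (hab : a ≤ b)
    (h : ∀ t ∈ Ioo a b, 0 ≤ f' t) : f a ≤ f b := by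
  have hmono : MonotoneOn f (Icc a b) := by
    refine monotoneOn_of_hasDerivWithinAt_nonneg (f' := f') (convex_Icc a b) ?_ ?_ ?_
    · intro t ht
      exact ((hf t (ha.trans ht.1)).continuousWithinAt).mono fun s hs => ha.trans hs.1
    · rw [interior_Icc]
      intro t ht
      exact (hf t (ha.trans ht.1.le)).mono fun s hs => ha.trans hs.1.le
    · rwa [interior_Icc]
  exact hmono (left_mem_Icc.2 hab) (right_mem_Icc.2 hab) hab

/-- A function which starts nonnegative and does not decrease while it is negative stays
nonnegative. -/
theorem nonneg_of_deriv_nonneg_of_neg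
    (hf : ∀ t, 0 ≤ t → HasDerivWithinAt f (f' t) (Ici 0) t) (ha : 0 ≤ a) (hab : a ≤ b)
    (hfa : 0 ≤ f a) (h : ∀ t ∈ Ioo a b, f t < 0 → 0 ≤ f' t) : 0 ≤ f b := by
  by_contra! hb
  have hcont : ContinuousOn f (Icc a b) := fun t ht =>
    ((hf t (ha.trans ht.1)).continuousWithinAt).mono fun s hs => ha.trans hs.1
  have hclosed : IsClosed (Icc a b ∩ f ⁻¹' Ici 0) :=
    hcont.preimage_isClosed_of_isClosed isClosed_Icc isClosed_Ici
  -- `s` is the last time with `f ≥ 0`; after it `f` is negative, hence does not decrease.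
  obtain ⟨s, ⟨hs, hfs⟩, hmax⟩ := (isCompact_Icc.of_isClosed_subset hclosed
    inter_subset_left).exists_isGreatest ⟨a, left_mem_Icc.2 hab, hfa⟩
  have hle : f s ≤ f b := by
    refine le_of_hasDerivWithinAt_Ici_nonneg hf (ha.trans hs.1) hs.2 fun t ht => ?_
    have hat : a < t := hs.1.trans_lt ht.1
    refine h t ⟨hat, ht.2⟩ ?_
    by_contra! hft
    exact absurd (hmax ⟨⟨hat.le, ht.2.le⟩, hft⟩) (not_le.2 ht.1)
  exact absurd (hle.trans_lt hb) (not_lt.2 hfs)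

/-- Integrated form of the differential inequality `f' ≥ κ (c - f)`. -/
theorem relaxation_lower_bound
    (hf : ∀ t, 0 ≤ t → HasDerivWithinAt f (f' t) (Ici 0) t) (ha : 0 ≤ a) (hab : a ≤ b)
    (h : ∀ t ∈ Ioo a b, κ * (c - f t) ≤ f' t) :
    c + (f a - c) * Real.exp (-(κ * (b - a))) ≤ f b := by
  have hexp : ∀ t, HasDerivAt (fun s => Real.exp (κ * s)) (Real.exp (κ * t) * κ) t := fun t => by
    simpa using ((hasDerivAt_id t).const_mul κ).exp
  -- Integrating factor `exp (κ t)`.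
  have key := le_of_hasDerivWithinAt_Ici_nonneg
    (f := fun s => (f s - c) * Real.exp (κ * s))
    (fun t ht => ((hf t ht).sub_const c).mul (hexp t).hasDerivWithinAt) ha hab (fun t ht => by
      have h1 := mul_nonneg (sub_nonneg.2 (h t ht)) (Real.exp_pos (κ * t)).le
      linarith)
  have hsplit : Real.exp (κ * a) = Real.exp (-(κ * (b - a))) * Real.exp (κ * b) := by
    rw [← Real.exp_add]; ring_nf
  rw [hsplit, ← mul_assoc] at key
  have := le_of_mul_le_mul_right key (Real.exp_pos (κ * b))
  linarith

/-- If `f' ≥ κ (c - f)` from some time on, then `f` eventually exceeds every level below `c`. -/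
theorem eventually_lt_of_relaxation {d : ℝ}
    (hf : ∀ t, 0 ≤ t → HasDerivWithinAt f (f' t) (Ici 0) t) (hκ : 0 < κ) (hd : d < c)
    (h : ∀ᶠ t in atTop, κ * (c - f t) ≤ f' t) : ∀ᶠ t in atTop, d < f t := by
  obtain ⟨T, hT⟩ := eventually_atTop.1 (h.and (eventually_ge_atTop 0))
  have hlim : Tendsto (fun t => c + (f T - c) * Real.exp (-(κ * (t - T)))) atTop (𝓝 c) := by
    have h1 : Tendsto (fun t : ℝ => κ * (t - T)) atTop atTop :=
      (tendsto_atTop_add_const_right _ (-T) tendsto_id).const_mul_atTop hκ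
    simpa using ((Real.tendsto_exp_neg_atTop_nhds_zero.comp h1).const_mul (f T - c)).const_add c
  filter_upwards [hlim.eventually_const_lt hd, eventually_ge_atTop T] with t ht hTt
  exact ht.trans_le (relaxation_lower_bound hf (hT T le_rfl).2 hTt fun s hs => (hT s hs.1.le).1)

/-- A positive function growing at an exponential rate while below the level `c` eventually stays
above `c`. -/
theorem eventually_ge_of_exponential_growth_below
    (hf : ∀ t, 0 ≤ t → HasDerivWithinAt f (f' t) (Ici 0) t) (hκ : 0 < κ)
    (hpos : ∀ t, 0 ≤ t → 0 < f t) (h : ∀ t, 0 ≤ t → f t < c → κ * f t ≤ f' t) :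
    ∀ᶠ t in atTop, c ≤ f t := by
  by_cases hex : ∃ T, 0 ≤ T ∧ c ≤ f T
  · obtain ⟨T, hT, hcT⟩ := hex
    filter_upwards [eventually_ge_atTop T] with t ht
    refine sub_nonneg.1 (nonneg_of_deriv_nonneg_of_neg (f := fun s => f s - c)
      (fun s hs => (hf s hs).sub_const c) hT ht (sub_nonneg.2 hcT) fun s hs hneg => ?_)
    have hs0 : 0 ≤ s := hT.trans hs.1.le
    exact (mul_pos hκ (hpos s hs0)).le.trans (h s hs0 (sub_neg.1 hneg))
  · push Not at hex
    exfalso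
    have hlim : Tendsto (fun t : ℝ => f 0 * Real.exp (κ * t)) atTop atTop :=
      (Real.tendsto_exp_atTop.comp (tendsto_id.const_mul_atTop hκ)).const_mul_atTop (hpos 0 le_rfl)
    obtain ⟨t, ht, ht0⟩ := ((hlim.eventually_ge_atTop c).and (eventually_ge_atTop 0)).exists
    -- With rate `-κ` and level `0` the inequality reads `f' ≥ κ f`, so `f` outgrows `c`.
    have hb := relaxation_lower_bound (κ := -κ) (c := 0) hf le_rfl ht0 fun s hs => by
      have := h s hs.1.le (hex s hs.1.le)
      linarith
    simp only [sub_zero, zero_add, neg_mul, neg_neg] at hb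
    exact absurd (ht.trans hb) (not_le.2 (hex t ht0))

end Comparison

namespace StreamingMarket

variable {N : ℕ} {mkt : StreamingMarket N} {β : ℝ} {n q : ℝ → Fin N → ℝ} {i j : Fin N}

/-! ### Logit choice probabilities -/

theorem sum_exp_utility_pos (mkt : StreamingMarket N) (β : ℝ) (q n : Fin N → ℝ) (i : Fin N) :
    0 < ∑ k, Real.exp (mkt.utility β q n k) :=
  Finset.sum_pos (fun _ _ => Real.exp_pos _) ⟨i, Finset.mem_univ i⟩

theorem choiceProb_pos (mkt : StreamingMarket N) (β : ℝ) (q n : Fin N → ℝ) (i : Fin N) :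
    0 < mkt.choiceProb β q n i :=
  div_pos (Real.exp_pos _) (mkt.sum_exp_utility_pos β q n i)

theorem sum_choiceProb (mkt : StreamingMarket N) (β : ℝ) (q n : Fin N → ℝ) (i : Fin N) :
    ∑ k, mkt.choiceProb β q n k = 1 := by
  simp only [choiceProb]
  rw [← Finset.sum_div, div_self (mkt.sum_exp_utility_pos β q n i).ne']

theorem choiceProb_eq_mul_exp (mkt : StreamingMarket N) (β : ℝ) (q n : Fin N → ℝ) (i j : Fin N) :
    mkt.choiceProb β q n j =
      mkt.choiceProb β q n i * Real.exp (mkt.utility β q n j - mkt.utility β q n i) := by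
  simp only [choiceProb]
  rw [div_mul_eq_mul_div, ← Real.exp_add]
  ring_nf

theorem choiceProb_le_choiceProb {q n : Fin N → ℝ}
    (h : mkt.utility β q n j ≤ mkt.utility β q n i) :
    mkt.choiceProb β q n j ≤ mkt.choiceProb β q n i :=
  div_le_div_of_nonneg_right (Real.exp_le_exp.2 h) (mkt.sum_exp_utility_pos β q n i).le

theorem choiceProb_le_one (mkt : StreamingMarket N) (β : ℝ) (q n : Fin N → ℝ) (i : Fin N) :
    mkt.choiceProb β q n i ≤ 1 := by
  rw [← mkt.sum_choiceProb β q n i]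
  exact Finset.single_le_sum (fun k _ => (mkt.choiceProb_pos β q n k).le) (Finset.mem_univ i)

theorem choiceProb_add_le_one (mkt : StreamingMarket N) (β : ℝ) (q n : Fin N → ℝ) (hij : i ≠ j) :
    mkt.choiceProb β q n i + mkt.choiceProb β q n j ≤ 1 := by
  rw [← mkt.sum_choiceProb β q n i, ← Finset.sum_pair hij]
  exact Finset.sum_le_sum_of_subset_of_nonneg (Finset.subset_univ _)
    fun k _ _ => (mkt.choiceProb_pos β q n k).le

/-- The marginal audience of the logit model is `M α_i P_i (1 - P_i)`. -/
theorem marginalAudience_eq (mkt : StreamingMarket N) (β : ℝ) (q n : Fin N → ℝ) (i : Fin N) :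
    mkt.marginalAudience β q n i =
      mkt.M * (mkt.α i * (mkt.choiceProb β q n i * (1 - mkt.choiceProb β q n i))) := by
  have hexp : ∀ k, HasDerivAt (fun x => Real.exp (mkt.utility β (Function.update q i x) n k))
      (if k = i then mkt.α i * Real.exp (mkt.utility β q n i) else 0) (q i) := by
    intro k
    by_cases hk : k = i
    · subst hk
      have h : HasDerivAt (fun x => mkt.α k * x - mkt.p k + β * n k) (mkt.α k) (q k) := by
        simpa using (((hasDerivAt_id (q k)).const_mul (mkt.α k)).sub_const (mkt.p k)).add_const
          (β * n k)
      simpa [utility, mul_comm] using h.exp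
    · simpa [utility, Function.update_of_ne hk, hk] using hasDerivAt_const (q i) _
  have hsum := HasDerivAt.fun_sum (u := Finset.univ) fun k _ => hexp k
  have hne := (mkt.sum_exp_utility_pos β q n i).ne'
  have hd := ((hexp i).div hsum (by simpa using hne)).const_mul mkt.M
  have := hd.deriv
  simp only [Function.update_eq_self, Finset.sum_ite_eq', Finset.mem_univ, if_true] at this
  unfold marginalAudience
  refine Eq.trans this ?_
  simp only [choiceProb]
  field_simp

theorem utility_sub_utility (hid : mkt.Identical) (β : ℝ) (q n : Fin N → ℝ) (i j : Fin N) :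
    mkt.utility β q n i - mkt.utility β q n j =
      mkt.α i * (q i - q j) + β * (n i - n j) := by
  simp only [utility]
  rw [hid.1 j i, hid.2.1 j i]
  ring

/-! ### Persistence of the lead and conservation of the audience -/

namespace IsTrajectory

/-- While streamer `i` is at least as attractive as `j`, a quality of `i` below that of `j`
catches up. -/
theorem quality_gap_deriv_nonneg (h : mkt.IsTrajectory β n q) (hid : mkt.Identical) (hij : i ≠ j)
    {t : ℝ} (ht : 0 ≤ t) (hu : mkt.utility β (q t) (n t) j ≤ mkt.utility β (q t) (n t) i)
    (hq : q t i ≤ q t j) :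
    0 ≤ mkt.η i * ((1 - mkt.τ) * mkt.R * mkt.marginalAudience β (q t) (n t) i
        - deriv mkt.c (q t i)) -
      mkt.η j * ((1 - mkt.τ) * mkt.R * mkt.marginalAudience β (q t) (n t) j
        - deriv mkt.c (q t j)) := by
  have hc : deriv mkt.c (q t i) ≤ deriv mkt.c (q t j) :=
    mkt.c_convex.monotoneOn_deriv mkt.c_differentiable (h.quality_mem t ht i)
      (h.quality_mem t ht j) hq
  have hm : mkt.marginalAudience β (q t) (n t) j ≤ mkt.marginalAudience β (q t) (n t) i := by
    rw [marginalAudience_eq, marginalAudience_eq, hid.1 j i]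
    refine mul_le_mul_of_nonneg_left (mul_le_mul_of_nonneg_left ?_ (mkt.α_pos i).le) mkt.M_pos.le
    -- The product is `(P_i - P_j) (1 - P_i - P_j)`.
    have h1 := mul_nonneg (sub_nonneg.2 (choiceProb_le_choiceProb hu))
      (sub_nonneg.2 (mkt.choiceProb_add_le_one β (q t) (n t) hij))
    linarith
  have hK : 0 ≤ (1 - mkt.τ) * mkt.R :=
    mul_nonneg (sub_nonneg.2 mkt.τ_le_one) mkt.R_pos.le
  rw [hid.2.2 j i, ← mul_sub]
  refine mul_nonneg (mkt.η_pos i).le ?_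
  linarith [mul_le_mul_of_nonneg_left hm hK]

theorem audience_gap_hasDeriv (h : mkt.IsTrajectory β n q) (i j : Fin N) (t : ℝ) (ht : 0 ≤ t) :
    HasDerivWithinAt (fun s => n s i - n s j)
      (mkt.γ * (mkt.M * (mkt.choiceProb β (q t) (n t) i - mkt.choiceProb β (q t) (n t) j)
        - (n t i - n t j))) (Ici 0) t :=
  ((h.viewer_eq t ht i).fun_sub (h.viewer_eq t ht j)).congr_deriv (by ring)

/-- If streamer `i` is ahead of `j` on a time interval `[0, T)`, its audience and its quality lead
those of `j` at time `T`. -/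
theorem lead_of_utility_lt_before (h : mkt.IsTrajectory β n q) (hid : mkt.Identical) (hij : i ≠ j)
    (hq : q 0 j = q 0 i) (hn : n 0 j < n 0 i) {T : ℝ} (hT : 0 ≤ T)
    (hu : ∀ t ∈ Ioo 0 T, mkt.utility β (q t) (n t) j ≤ mkt.utility β (q t) (n t) i) :
    n T j < n T i ∧ q T j ≤ q T i := by
  constructor
  -- The gap satisfies `x' ≥ -γ x`, so it decays at most exponentially and stays positive.
  · have hb := relaxation_lower_bound (κ := mkt.γ) (c := 0) (h.audience_gap_hasDeriv i j) le_rfl hT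
      fun t ht => by
        refine mul_le_mul_of_nonneg_left ?_ mkt.γ_pos.le
        have := mul_nonneg mkt.M_pos.le (sub_nonneg.2 (choiceProb_le_choiceProb (hu t ht)))
        linarith
    have := mul_pos (sub_pos.2 hn) (Real.exp_pos (-(mkt.γ * (T - 0))))
    simp only [sub_zero, zero_add] at hb this
    linarith
  · refine sub_nonneg.1 (nonneg_of_deriv_nonneg_of_neg (f := fun s => q s i - q s j)
      (fun t ht => (h.quality_eq t ht i).fun_sub (h.quality_eq t ht j)) le_rfl hT
      (by simp [hq]) fun t ht hneg => ?_)
    exact h.quality_gap_deriv_nonneg hid hij ht.1.le (hu t ht) (sub_neg.1 hneg).le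

/-- With identical streamers, the initial leader keeps its lead in audience, and does not fall
behind in quality. -/
theorem lead_persists (h : mkt.IsTrajectory β n q) (hid : mkt.Identical) (hβ : 0 < β) (hij : i ≠ j)
    (hq : q 0 j = q 0 i) (hn : n 0 j < n 0 i) {t : ℝ} (ht : 0 ≤ t) :
    n t j < n t i ∧ q t j ≤ q t i := by
  have hgap : ∀ s, n s j < n s i → q s j ≤ q s i →
      mkt.utility β (q s) (n s) j < mkt.utility β (q s) (n s) i := fun s h1 h2 => by
    have := utility_sub_utility hid β (q s) (n s) i j
    have h3 := mul_pos hβ (sub_pos.2 h1)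
    have h4 := mul_nonneg (mkt.α_pos i).le (sub_nonneg.2 h2)
    linarith
  refine h.lead_of_utility_lt_before hid hij hq hn ht fun s hs => ?_
  by_contra! hlt
  have hcu : ∀ k, ContinuousOn (fun r => mkt.utility β (q r) (n r) k) (Icc 0 s) := fun k r hr => by
    have h1 := (h.viewer_eq r hr.1 k).continuousWithinAt.mono (Icc_subset_Ici_self : Icc 0 s ⊆ _)
    have h2 := (h.quality_eq r hr.1 k).continuousWithinAt.mono (Icc_subset_Ici_self : Icc 0 s ⊆ _)
    exact ((h2.const_mul _).sub continuousWithinAt_const).add (h1.const_mul _)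
  have hclosed : IsClosed (Icc 0 s ∩ (fun r => mkt.utility β (q r) (n r) i
      - mkt.utility β (q r) (n r) j) ⁻¹' Iic 0) :=
    ((hcu i).sub (hcu j)).preimage_isClosed_of_isClosed isClosed_Icc isClosed_Iic
  -- At the first time `T` when the utility lead is lost, both leads still hold, and they make the
  -- utility lead strict.
  obtain ⟨T, ⟨hT, huT⟩, hmin⟩ := (isCompact_Icc.of_isClosed_subset hclosed
    inter_subset_left).exists_isLeast ⟨s, right_mem_Icc.2 hs.1.le, (sub_neg.2 hlt).le⟩
  have hlead := h.lead_of_utility_lt_before hid hij hq hn hT.1 fun r hr => by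
    by_contra! hr'
    exact absurd (hmin ⟨⟨hr.1.le, hr.2.le.trans hT.2⟩, (sub_neg.2 hr').le⟩) (not_le.2 hr.2)
  exact absurd (sub_nonpos.1 huT) (not_le.2 (hgap T hlead.1 hlead.2))

theorem audience_nonneg (h : mkt.IsTrajectory β n q) (i : Fin N) {t : ℝ} (ht : 0 ≤ t) :
    0 ≤ n t i := by
  have hb := relaxation_lower_bound (κ := mkt.γ) (c := 0) (fun s hs => h.viewer_eq s hs i) le_rfl ht
    fun s _ => by
      refine mul_le_mul_of_nonneg_left ?_ mkt.γ_pos.le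
      have := mul_pos mkt.M_pos (mkt.choiceProb_pos β (q s) (n s) i)
      linarith
  have := mul_nonneg (h.initial_nonneg i) (Real.exp_pos (-(mkt.γ * (t - 0)))).le
  simp only [sub_zero, zero_add] at hb this
  linarith

/-- The total audience is conserved. -/
theorem sum_audience (h : mkt.IsTrajectory β n q) (i : Fin N) {t : ℝ} (ht : 0 ≤ t) :
    ∑ k, n t k = mkt.M := by
  have hd : ∀ s, 0 ≤ s → HasDerivWithinAt (fun r => ∑ k, n r k)
      (mkt.γ * (mkt.M - ∑ k, n s k)) (Ici 0) s := fun s hs => by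
    refine (HasDerivWithinAt.fun_sum fun k _ => h.viewer_eq s hs k).congr_deriv ?_
    rw [← Finset.mul_sum, Finset.sum_sub_distrib, ← Finset.mul_sum, mkt.sum_choiceProb _ _ _ i,
      mul_one]
  have h1 := relaxation_lower_bound (κ := mkt.γ) (c := mkt.M) hd le_rfl ht fun s _ => le_rfl
  -- The total obeys a linear equation with equilibrium `M`; applying the bound to its negative
  -- gives the other inequality.
  have h2 := relaxation_lower_bound (κ := mkt.γ) (c := -mkt.M) (fun s hs => (hd s hs).neg) le_rfl ht
    fun s _ => by simp only [Pi.neg_apply]; linarith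
  simp only [Pi.neg_apply, h.initial_sum, sub_self, zero_mul, add_zero] at h1 h2
  linarith

/-! ### Growth of the lead under strong network effects -/

/-- For a strong network effect, a leader's audience advantage over each rival eventually exceeds
half of the average audience. -/
theorem eventually_audience_gap_ge (h : mkt.IsTrajectory β n q) (hid : mkt.Identical)
    (hβ : 6 * N / mkt.M ≤ β) (hq : ∀ k, q 0 k = q 0 i) (hi : ∀ k, k ≠ i → n 0 k < n 0 i)
    (hij : j ≠ i) : ∀ᶠ t in atTop, mkt.M / (2 * N) ≤ n t i - n t j := by
  have hM := mkt.M_pos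
  have hN : (0 : ℝ) < N := Nat.cast_pos.2 (Fin.pos i)
  have hβM : 6 * N ≤ β * mkt.M := (div_le_iff₀ hM).1 hβ
  have hβ0 : 0 < β := lt_of_lt_of_le (by positivity) hβ
  have hlead : ∀ k, k ≠ i → ∀ t, 0 ≤ t → n t k < n t i ∧ q t k ≤ q t i := fun k hk t ht =>
    h.lead_persists hid hβ0 hk.symm (hq k) (hi k hk) ht
  refine eventually_ge_of_exponential_growth_below (h.audience_gap_hasDeriv i j)
    (κ := mkt.γ / 2) (half_pos mkt.γ_pos) (fun t ht => sub_pos.2 (hlead j hij t ht).1) ?_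
  intro t ht hlt
  set x := n t i - n t j with hx
  have hx0 : 0 < x := sub_pos.2 (hlead j hij t ht).1
  have hudiff : ∀ k, k ≠ i → β * (n t i - n t k) ≤
      mkt.utility β (q t) (n t) i - mkt.utility β (q t) (n t) k := fun k hk => by
    rw [utility_sub_utility hid]
    have := mul_nonneg (mkt.α_pos i).le (sub_nonneg.2 (hlead k hk t ht).2)
    linarith
  set P := mkt.choiceProb β (q t) (n t) with hP
  have hPi : 1 / N ≤ P i := by
    rw [div_le_iff₀ hN, ← mkt.sum_choiceProb β (q t) (n t) i]
    have := Finset.sum_le_card_nsmul Finset.univ P (P i) fun k _ => by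
      by_cases hk : k = i
      · rw [hk]
      · refine choiceProb_le_choiceProb (sub_nonneg.1 (le_trans ?_ (hudiff k hk)))
        exact mul_nonneg hβ0.le (sub_pos.2 (hlead k hk t ht).1).le
    simpa [mul_comm] using this
  have hPj : P j ≤ P i / (1 + β * x) := by
    rw [hP, mkt.choiceProb_eq_mul_exp β (q t) (n t) i j, ← hP, div_eq_mul_inv]
    refine mul_le_mul_of_nonneg_left ?_ (mkt.choiceProb_pos β (q t) (n t) i).le
    rw [← neg_sub, Real.exp_neg]
    refine inv_anti₀ (by positivity) ?_
    linarith [Real.add_one_le_exp (β * x), Real.exp_le_exp.2 (hudiff j hij)]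
  have hbx : 0 < 1 + β * x := by positivity
  have hdiff : 1 / N * (β * x / (1 + β * x)) ≤ P i - P j := by
    calc 1 / N * (β * x / (1 + β * x)) ≤ P i * (β * x / (1 + β * x)) :=
          mul_le_mul_of_nonneg_right hPi (by positivity)
      _ = P i - P i / (1 + β * x) := by field_simp; ring
      _ ≤ P i - P j := by linarith
  have hxN : x * (2 * N) < mkt.M := (lt_div_iff₀ (by positivity)).1 hlt
  -- Needs `3/2 * N * (1 + β x) ≤ β M`: as `x < M / (2N)`, the left side is at most `3/2 * N + 3/4 *
  -- β M`, whence the threshold `6 N ≤ β M`. The surplus `x / 2` gives growth rate `γ / 2`.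
  have hmain : 3 / 2 * x ≤ mkt.M * (P i - P j) := by
    refine le_trans ?_ (mul_le_mul_of_nonneg_left hdiff hM.le)
    rw [show mkt.M * (1 / N * (β * x / (1 + β * x))) = x * (β * mkt.M / (N * (1 + β * x))) by
      field_simp, mul_comm]
    refine mul_le_mul_of_nonneg_left ?_ hx0.le
    rw [le_div_iff₀ (by positivity)]
    have := mul_le_mul_of_nonneg_left hxN.le hβ0.le
    linarith
  have := mul_le_mul_of_nonneg_left hmain mkt.γ_pos.le
  linarith

/-- For a strong network effect, the leader's choice probability is eventually close to `1`. -/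
theorem eventually_choiceProb_ge (h : mkt.IsTrajectory β n q) (hid : mkt.Identical)
    (hβ : 6 * N / mkt.M ≤ β) {δ : ℝ} (hδ : 0 < δ) (hβδ : 2 * N ^ 2 / (mkt.M * δ) ≤ β)
    (hq : ∀ k, q 0 k = q 0 i) (hi : ∀ k, k ≠ i → n 0 k < n 0 i) :
    ∀ᶠ t in atTop, 1 - δ ≤ mkt.choiceProb β (q t) (n t) i := by
  have hM := mkt.M_pos
  have hN : (0 : ℝ) < N := Nat.cast_pos.2 (Fin.pos i)
  have hβ0 : 0 < β := lt_of_lt_of_le (by positivity) hβ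
  have hgap : ∀ᶠ t in atTop, ∀ j, j ≠ i → mkt.M / (2 * N) ≤ n t i - n t j := by
    rw [eventually_all]
    intro j
    by_cases hj : j = i
    · simp [hj]
    · filter_upwards [h.eventually_audience_gap_ge hid hβ hq hi hj] with t ht _ using ht
  filter_upwards [hgap, eventually_ge_atTop 0] with t hgt ht
  have hPj : ∀ j ∈ Finset.univ.erase i, mkt.choiceProb β (q t) (n t) j ≤ δ / N := by
    intro j hj
    have hj := Finset.ne_of_mem_erase hj
    rw [mkt.choiceProb_eq_mul_exp β (q t) (n t) i j]
    refine (mul_le_of_le_one_left (Real.exp_pos _).le (mkt.choiceProb_le_one β _ _ i)).trans ?_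
    -- A utility gap `N / δ` suffices because `exp (-y) ≤ 1 / y`; the rivals' probabilities then
    -- total at most `δ`.
    have hu : N / δ ≤ mkt.utility β (q t) (n t) i - mkt.utility β (q t) (n t) j := by
      rw [utility_sub_utility hid]
      have h1 := mul_nonneg (mkt.α_pos i).le
        (sub_nonneg.2 (h.lead_persists hid hβ0 hj.symm (hq j) (hi j hj) ht).2)
      have h2 := mul_le_mul_of_nonneg_left (hgt j hj) hβ0.le
      have h3 := mul_le_mul_of_nonneg_right hβδ (show 0 ≤ mkt.M / (2 * N) by positivity)
      have h4 : 2 * (N : ℝ) ^ 2 / (mkt.M * δ) * (mkt.M / (2 * N)) = N / δ := by field_simp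
      linarith
    rw [← neg_sub, Real.exp_neg, ← inv_div]
    refine inv_anti₀ (by positivity) ?_
    linarith [Real.add_one_le_exp
      (mkt.utility β (q t) (n t) i - mkt.utility β (q t) (n t) j)]
  have hsum := Finset.sum_le_card_nsmul _ _ _ hPj
  have hcard : ((Finset.univ.erase i).card : ℝ) ≤ N := by
    exact_mod_cast (Finset.card_erase_le).trans (by simp)
  have hle : ((Finset.univ.erase i).card : ℝ) * (δ / N) ≤ δ :=
    (mul_le_mul_of_nonneg_right hcard (by positivity)).trans_eq (by field_simp)
  have htot := Finset.add_sum_erase Finset.univ (mkt.choiceProb β (q t) (n t)) (Finset.mem_univ i)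
  rw [mkt.sum_choiceProb β (q t) (n t) i] at htot
  rw [nsmul_eq_mul] at hsum
  linarith

end IsTrajectory

/-! ### From audience to dominance -/

/-- A streamer holding nearly the whole audience dominates. -/
theorem dominates_of_audience_gt {ν : Fin N → ℝ} {ε : ℝ} (hε : 0 < ε) (hnn : ∀ k, 0 ≤ ν k)
    (hsum : ∑ k, ν k = mkt.M) (hi : mkt.M * (1 - ε / 2) < ν i) : mkt.Dominates ε ν i := by
  have hM := mkt.M_pos
  have hs0 : ∀ k, 0 ≤ mkt.share ν k := fun k => div_nonneg (hnn k) hM.le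
  have hs1 : ∑ k, mkt.share ν k = 1 := by
    simp only [share]
    rw [← Finset.sum_div, hsum, div_self hM.ne']
  have hle : ∀ k, mkt.share ν k ≤ 1 := fun k => by
    rw [← hs1]
    exact Finset.single_le_sum (fun l _ => hs0 l) (Finset.mem_univ k)
  have hsi : 1 - ε / 2 < mkt.share ν i := by
    rw [share, lt_div_iff₀ hM]; linarith
  refine ⟨?_, fun j hj => ?_, ?_⟩
  · rw [abs_lt]; constructor <;> linarith [hle i]
  · have : mkt.share ν i + mkt.share ν j ≤ 1 := by
      rw [← hs1, ← Finset.sum_pair hj.symm]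
      exact Finset.sum_le_sum_of_subset_of_nonneg (Finset.subset_univ _) fun k _ _ => hs0 k
    rw [abs_of_nonneg (hs0 j)]; linarith
  · have h1 : mkt.hhi ν ≤ 1 := by
      rw [← hs1]
      exact Finset.sum_le_sum fun k _ => pow_le_of_le_one (hs0 k) (hle k) two_ne_zero
    have h2 : mkt.share ν i ^ 2 ≤ mkt.hhi ν :=
      Finset.single_le_sum (f := fun k => mkt.share ν k ^ 2) (fun k _ => sq_nonneg _)
        (Finset.mem_univ i)
    -- Lower bound: `s_i ^ 2 ≥ 2 s_i - 1 > 1 - ε`.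
    rw [abs_lt]; constructor <;> nlinarith [sq_nonneg (mkt.share ν i - 1)]

/-- For a strong network effect, an initial leader eventually dominates. -/
theorem IsTrajectory.eventually_dominates (h : mkt.IsTrajectory β n q) (hid : mkt.Identical)
    {ε : ℝ} (hε : 0 < ε) (hβ : 6 * N / mkt.M ≤ β) (hβε : 2 * N ^ 2 / (mkt.M * (ε / 4)) ≤ β)
    (hq : ∀ k, q 0 k = q 0 i) (hi : ∀ k, k ≠ i → n 0 k < n 0 i) :
    ∀ᶠ t in atTop, mkt.Dominates ε (n t) i := by
  have hM := mkt.M_pos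
  have hrelax : ∀ᶠ t in atTop, mkt.γ * (mkt.M * (1 - ε / 4) - n t i) ≤
      mkt.γ * (mkt.M * mkt.choiceProb β (q t) (n t) i - n t i) := by
    filter_upwards [h.eventually_choiceProb_ge hid hβ (by positivity : 0 < ε / 4) hβε hq hi]
      with t ht
    exact mul_le_mul_of_nonneg_left
      (sub_le_sub_right (mul_le_mul_of_nonneg_left ht hM.le) _) mkt.γ_pos.le
  -- Relaxation only reaches levels strictly below its target, hence `ε / 4` for the probability and
  -- `ε / 2` for the share.
  have hlt : mkt.M * (1 - ε / 2) < mkt.M * (1 - ε / 4) :=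
    mul_lt_mul_of_pos_left (by linarith) hM
  filter_upwards [eventually_lt_of_relaxation (fun t ht => h.viewer_eq t ht i) mkt.γ_pos hlt hrelax,
    eventually_ge_atTop 0] with t ht ht0
  exact dominates_of_audience_gt hε (fun k => h.audience_nonneg k ht0) (h.sum_audience i ht0) ht

end StreamingMarket

theorem mainTheorem6 {N : ℕ} (mkt : StreamingMarket N) (hid : mkt.Identical) :
    ∀ ε : ℝ, 0 < ε → ∃ β₀ : ℝ, 0 < β₀ ∧ ∀ β : ℝ, β₀ ≤ β → ∀ q₀ : ℝ,
      -- every initial audience profile with a strict leader `i`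
      (∀ (n q : ℝ → Fin N → ℝ), mkt.IsTrajectory β n q → (∀ i, q 0 i = q₀) →
        ∀ i, (∀ j, j ≠ i → n 0 j < n 0 i) →
          ∀ᶠ t in Filter.atTop, mkt.Dominates ε (n t) i) ∧
      -- random initial audiences, almost surely without ties
      (∀ (Ω : Type*) [MeasurableSpace Ω] (ℙ : MeasureTheory.Measure Ω)
        [MeasureTheory.IsProbabilityMeasure ℙ] (n q : Ω → ℝ → Fin N → ℝ),
        (∀ᵐ ω ∂ℙ, mkt.IsTrajectory β (n ω) (q ω) ∧ ∀ i, q ω 0 i = q₀) →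
        (∀ i j, i ≠ j → ∀ᵐ ω ∂ℙ, n ω 0 i ≠ n ω 0 j) →
          ∀ᵐ ω ∂ℙ, ∃ i, (∀ j, j ≠ i → n ω 0 j < n ω 0 i) ∧
            ∀ᶠ t in Filter.atTop, mkt.Dominates ε (n ω t) i) := by
  intro ε hε
  have hM := mkt.M_pos
  have h1 : 0 ≤ 6 * N / mkt.M := by positivity
  have h2 : 0 ≤ 2 * (N : ℝ) ^ 2 / (mkt.M * (ε / 4)) := by positivity
  -- The sum exceeds both thresholds; the `1` keeps it positive when `N = 0`.
  refine ⟨6 * N / mkt.M + 2 * N ^ 2 / (mkt.M * (ε / 4)) + 1, by positivity, fun β hβ q₀ => ?_⟩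
  have hleader : ∀ (n q : ℝ → Fin N → ℝ), mkt.IsTrajectory β n q → (∀ i, q 0 i = q₀) →
      ∀ i, (∀ j, j ≠ i → n 0 j < n 0 i) → ∀ᶠ t in Filter.atTop, mkt.Dominates ε (n t) i :=
    fun n q h hq i hi => h.eventually_dominates hid hε (by linarith) (by linarith)
      (fun k => (hq k).trans (hq i).symm) hi
  refine ⟨hleader, fun Ω _ ℙ _ n q htraj hties => ?_⟩
  have hdistinct : ∀ᵐ ω ∂ℙ, ∀ i j, i ≠ j → n ω 0 i ≠ n ω 0 j := by
    simp only [MeasureTheory.ae_all_iff]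
    exact hties
  filter_upwards [htraj, hdistinct] with ω hω hne
  have : Nonempty (Fin N) := by
    by_contra hempty
    rw [not_nonempty_iff] at hempty
    have := hω.1.initial_sum
    rw [Finset.univ_eq_empty, Finset.sum_empty] at this
    exact hM.ne this
  obtain ⟨i, hi⟩ := Finite.exists_max fun k => n ω 0 k
  have hlead : ∀ j, j ≠ i → n ω 0 j < n ω 0 i := fun j hj => lt_of_le_of_ne (hi j) (hne j i hj)
  exact ⟨i, hlead, hleader (n ω) (q ω) hω.1 hω.2 i hlead⟩
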